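/- Let $n\ge 2$, let $d$ be an even integer with $d\ge 2+\frac{4}{n-1}$, and let $r\le n+1$. For $k\ge 0$ let $S^k=\mathbb{C}[x_0,\dots,x_n]_k$ be the space of complex forms of degree $k$ in $n+1$ variables (including $0$), with the Zariski topology. Let $$\sigma_r(\mathrm{Sq}_{d,n})=\overline{\Big\{\sum_{i=1}^r g_i^2 \;:\; g_1,\dots,g_r\in S^{d/2}\Big\}}\subseteq S^d$$ be the affine $r$-secant variety of the variety of squares. The complex orthogonal group $\mathrm{O}(r)=\{A\in\mathbb{C}^{r\times r}: AA^{T}=I\}$ acts on the decompositions $f=\sum_{i=1}^r f_i^2$ with $f_i\in S^{d/2}$ by $(f_i)_i\mapsto\big(\sum_{j} A_{ij}f_j\big)_i$. A form $f \in S^d$ is called $\mathrm{O}(r)$-identifiable if $r$ is the least number of squares of forms of degree $d/2$ whose sum is $f$, and the decompositions $(f_1,\dots,f_r)\in (S^{d/2})^r$ of $f$ as $\sum_{i=1}^r f_i^2$ form exactly one $\mathrm{O}(r)$-orbit. Then $\sigma_r(\mathrm{Sq}_{d,n})$ is generically $\mathrm{O}(r)$-identifiable: there is a Zariski open dense subset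 of $\sigma_r(\mathrm{Sq}_{d,n})$ all of whose elements are $\mathrm{O}(r)$-identifiable. -/

import Mathlib

open MvPolynomial

/-- `Form n k` is the complex vector space of forms (homogeneous polynomials) of degree `k` in the
variables `x₀, …, xₙ`; the zero polynomial is included. -/
abbrev Form (n k : ℕ) : Type := homogeneousSubmodule (Fin (n + 1)) ℂ k

/-- The value at the form `f` of a polynomial `P` in the coefficients of `f`
(one variable of `P` for each exponent vector). -/
noncomputable def evalCoeffs {n k : ℕ} (P : MvPolynomial (Fin (n + 1) →₀ ℕ) ℂ) (f : Form n k) : ℂ :=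
  eval (fun m => coeff m (f : MvPolynomial (Fin (n + 1)) ℂ)) P

/-- The common zero locus, in the space of forms, of a set of polynomials in the coefficients. -/
def zeroSet {n k : ℕ} (S : Set (MvPolynomial (Fin (n + 1) →₀ ℕ) ℂ)) : Set (Form n k) :=
  {f | ∀ P ∈ S, evalCoeffs P f = 0}

/-- The Zariski topology on the affine space of forms of degree `k`: the closed sets are the
common zero loci of polynomials in the coefficients. -/
instance zariskiTopology (n k : ℕ) : TopologicalSpace (Form n k) :=
  TopologicalSpace.ofClosed {Z | ∃ S, Z = zeroSet S}
    ⟨{1}, by ext f; simp [zeroSet, evalCoeffs]⟩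
    (by
      intro A hA
      refine ⟨{P | ∃ S, zeroSet S ∈ A ∧ P ∈ S}, ?_⟩
      ext f
      constructor
      · rintro hf P ⟨S, hS, hP⟩
        exact hf _ hS P hP
      · intro hf Z hZ
        obtain ⟨S, rfl⟩ := hA hZ
        exact fun P hP => hf P ⟨S, hZ, hP⟩)
    (by
      rintro _ ⟨S, rfl⟩ _ ⟨T, rfl⟩
      refine ⟨{R | ∃ P ∈ S, ∃ Q ∈ T, R = P * Q}, ?_⟩
      ext f
      constructor
      · rintro (hf | hf)
        · rintro _ ⟨P, hP, Q, hQ, rfl⟩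
          have h0 := hf P hP
          simp only [evalCoeffs] at h0
          simp [evalCoeffs, h0]
        · rintro _ ⟨P, hP, Q, hQ, rfl⟩
          have h0 := hf Q hQ
          simp only [evalCoeffs] at h0
          simp [evalCoeffs, h0]
      · intro hf
        by_contra hcon
        simp only [Set.mem_union, not_or, zeroSet, Set.mem_ofPred_eq, not_forall] at hcon
        obtain ⟨⟨P, hP, hP0⟩, ⟨Q, hQ, hQ0⟩⟩ := hcon
        have h0 := hf (P * Q) ⟨P, hP, Q, hQ, rfl⟩
        simp only [evalCoeffs, map_mul, mul_eq_zero] at h0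
        exact h0.elim hP0 hQ0)

theorem isClosed_iff_exists_zeroSet {n k : ℕ} (Z : Set (Form n k)) :
    IsClosed Z ↔ ∃ S, Z = zeroSet S :=
  ⟨fun h => by
    have h1 : Zᶜᶜ ∈ {Z | ∃ S, Z = zeroSet (n := n) (k := k) S} := h.isOpen_compl
    simpa using h1, fun h => ⟨by
    change Zᶜᶜ ∈ {Z | ∃ S, Z = zeroSet S}
    simpa using h⟩⟩

/-- The decompositions `(g₁, …, g_r)` of `f` as a sum of `r` squares of forms of degree `d / 2`
(used for even `d`; some of the `gᵢ` may be zero). -/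
def sosDecompositions {n d : ℕ} (r : ℕ) (f : Form n d) : Set (Fin r → Form n (d / 2)) :=
  {g | (f : MvPolynomial (Fin (n + 1)) ℂ) = ∑ i, (g i : MvPolynomial (Fin (n + 1)) ℂ) ^ 2}

/-- The set of all sums of `r` squares of forms of degree `d / 2`. -/
def sumsOfSquares (n d r : ℕ) : Set (Form n d) :=
  {f | (sosDecompositions r f).Nonempty}

/-- The affine `r`-secant variety of the variety of squares: the Zariski closure of the set of
sums of `r` squares. -/
def secantSq (n d r : ℕ) : Set (Form n d) :=
  closure (sumsOfSquares n d r)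

/-- The `2`-rank of `f`: the least number of squares needed to write `f`. -/
noncomputable def twoRank {n d : ℕ} (f : Form n d) : ℕ :=
  sInf {r | f ∈ sumsOfSquares n d r}

/-- The orbit of `(g₁, …, g_r)` under the complex orthogonal group `O(r)`
(matrices with `A Aᵀ = 1`, no complex conjugation), where `A` sends `g` to the tuple with
entries `∑ⱼ Aᵢⱼ gⱼ`. -/
def orthogonalOrbit {n k r : ℕ} (g : Fin r → Form n k) : Set (Fin r → Form n k) :=
  {h | ∃ A : Matrix (Fin r) (Fin r) ℂ, A * A.transpose = 1 ∧ ∀ i, h i = ∑ j, A i j • g j}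

/-- `f` is `O(r)`-identifiable: it has a decomposition as a sum of `r` squares, `r` is minimal,
and all its decompositions as a sum of `r` squares form one single `O(r)`-orbit. -/
def IsOrthIdentifiable {n d : ℕ} (r : ℕ) (f : Form n d) : Prop :=
  twoRank f = r ∧ ∃ g ∈ sosDecompositions r f, sosDecompositions r f = orthogonalOrbit g

/-- The general element of `X` satisfies `p`: there is an open set `U` such that `X ∩ U` is
dense in `X` and `p` holds at every point of `X ∩ U`. -/
def HoldsGenerically {n d : ℕ} (X : Set (Form n d)) (p : Form n d → Prop) : Prop :=
  ∃ U : Set (Form n d), IsOpen U ∧ X ⊆ closure (X ∩ U) ∧ ∀ f ∈ X ∩ U, p f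

/-! Put k = d/2 and let φ send a tuple g to ∑ gᵢ². Up to the factor 2, the differential of φ at g is
w ↦ ∑ gᵢwᵢ, so its image is the degree-2k part of the ideal (g₁, …, g_r).

For generic g this image is the whole Zariski tangent space of the secant variety at f = φ(g)
(`exists_generic_tangent`; characteristic zero enters here). If h is another decomposition of f, the
image of the differential at h lies in the same tangent space, so hᵢq ∈ (g) for every form q of
degree k (`exists_generic_mul_mem_ideal`).

For generic g this forces hᵢ into the span of the gⱼ, so h = Ag. Generic g also has only Koszul
syzygies in degree k, so the products gᵢgⱼ (i ≤ j) are linearly independent and AᵀA = 1. Both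
properties, with independence of the gᵢ, form `IsKoszulSaturated`. They say that certain complexes
depending polynomially on g are exact, which is an open condition (`exists_generic_exact`). It
therefore suffices to check one tuple, the pure powers xᵢᵏ, and there the bound on d is used.

Chevalley's theorem (`exists_preimage_of_generic`) turns genericity of g into genericity of f.
Minimality of r follows because a shorter decomposition, padded by zeros, would lie in the orbit of
an independent tuple. -/

/-! ### Tangent vectors as points over the dual numbers -/

/-- Taylor expansion to first order: the value of a polynomial at a tangent vector. -/
theorem aeval_inl_add_inr {σ R L : Type*} [Fintype σ] [CommRing R] [CommRing L] [Algebra R L]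
    (a w : σ → L) (P : MvPolynomial σ R) :
    aeval (fun i => (TrivSqZeroExt.inl (a i) + TrivSqZeroExt.inr (w i) : TrivSqZeroExt L L)) P =
      TrivSqZeroExt.inl (aeval a P) +
        TrivSqZeroExt.inr (∑ i, aeval a (pderiv i P) * w i) := by
  classical
  induction P using MvPolynomial.induction_on with
  | C r =>
    ext <;> simp [TrivSqZeroExt.algebraMap_eq_inl']
  | add p q hp hq =>
    simp only [map_add, hp, hq, add_mul, Finset.sum_add_distrib, TrivSqZeroExt.inl_add,
      TrivSqZeroExt.inr_add]
    abel
  | mul_X p j hp =>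
    simp only [map_mul, hp, aeval_X, Derivation.leibniz, pderiv_X, smul_eq_mul, map_add, add_mul,
      Finset.sum_add_distrib]
    ext
    · simp
    · simp [Pi.single_apply, apply_ite, mul_comm, Finset.mul_sum, mul_left_comm]

/-- Formal smoothness of a finitely generated field extension in characteristic zero, as a
lifting property along a surjection with nilpotent kernel. -/
theorem exists_section_of_charZero {K L E : Type*} [Field K] [CharZero K] [Field L] [CommRing E]
    (f : K →+* L) (h : K →+* E) (π : E →+* L) (hπ : π.comp h = f)
    (hsurj : Function.Surjective π) (hker : IsNilpotent (RingHom.ker π))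
    (hf : @Algebra.EssFiniteType K L _ _ f.toAlgebra) :
    ∃ s : L →+* E, π.comp s = RingHom.id L ∧ s.comp f = h := by
  let := f.toAlgebra
  let := h.toAlgebra
  let π' : E →ₐ[K] L := ⟨π, fun x => RingHom.congr_fun hπ x⟩
  let s := Algebra.FormallySmooth.liftOfSurjective (AlgHom.id K L) π' hsurj hker
  refine ⟨s.toRingHom, ?_, ?_⟩
  · ext x
    exact Algebra.FormallySmooth.liftOfSurjective_apply (AlgHom.id K L) π' hsurj hker x
  · ext x
    exact s.commutes x

/-- A vector killed by the differentials of all the relations between the `φ t` is tangent: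
it lies in the image of the Jacobian matrix of `φ` over the function field. -/
theorem exists_tangent_lift {ι τ : Type*} [Fintype ι] [Fintype τ] {k : Type*} [Field k]
    [CharZero k] (φ : τ → MvPolynomial ι k) (L : Type*) [Field L] [Algebra (MvPolynomial ι k) L]
    [IsFractionRing (MvPolynomial ι k) L] [Algebra k L] [IsScalarTower k (MvPolynomial ι k) L]
    (v : τ → L)
    (hv : ∀ P : MvPolynomial τ k, aeval φ P = 0 →
      ∑ t, algebraMap _ L (aeval φ (pderiv t P)) * v t = 0) :
    ∃ w : ι → L, ∀ t, v t = ∑ i, algebraMap _ L (pderiv i (φ t)) * w i := by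
  let a : τ → L := fun t => algebraMap (MvPolynomial ι k) L (φ t)
  have ha : ∀ P : MvPolynomial τ k, aeval a P = algebraMap (MvPolynomial ι k) L (aeval φ P) := fun P =>
    aeval_algebraMap_apply L φ P
  -- The vector `v` is encoded as the point a + εv over the dual numbers; `hv` says exactly that all
  -- relations vanish there.
  let ψ : MvPolynomial τ k →ₐ[k] TrivSqZeroExt L L :=
    aeval (fun t => TrivSqZeroExt.inl (a t) + TrivSqZeroExt.inr (v t))
  let I : Ideal (MvPolynomial τ k) := RingHom.ker (aeval a : MvPolynomial τ k →ₐ[k] L)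
  have hIψ : ∀ P ∈ I, ψ P = 0 := by
    intro P hP
    have h0 : aeval a P = 0 := hP
    have h1 : aeval φ P = 0 := by
      rw [ha] at h0
      exact (IsFractionRing.injective (MvPolynomial ι k) L) (by simpa using h0)
    have h2 := hv P h1
    simp only [← ha] at h2
    simp only [ψ, aeval_inl_add_inr, h0]
    rw [h2]
    simp
  have : I.IsPrime := RingHom.ker_isPrime _
  let A := MvPolynomial τ k ⧸ I
  let K := FractionRing A
  let fA : A →ₐ[k] L := Ideal.Quotient.liftₐ I (aeval a) (fun P hP => hP)
  let hA : A →ₐ[k] TrivSqZeroExt L L := Ideal.Quotient.liftₐ I ψ hIψ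
  have hfA : Function.Injective fA := by
    rw [injective_iff_map_eq_zero]
    intro x hx
    obtain ⟨P, rfl⟩ := Ideal.Quotient.mk_surjective x
    exact Ideal.Quotient.eq_zero_iff_mem.mpr hx
  have hfst : ∀ x, (hA x).fst = fA x := by
    intro x
    obtain ⟨P, rfl⟩ := Ideal.Quotient.mk_surjective x
    change (ψ P).fst = aeval a P
    simp only [ψ, aeval_inl_add_inr]
    simp
  -- A dual number is a unit once its first component is, so `hA` extends to the function field `K`
  -- of the image.
  have hunit : ∀ y : nonZeroDivisors A, IsUnit (hA y) := by
    intro y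
    rw [TrivSqZeroExt.isUnit_iff_isUnit_fst, hfst, isUnit_iff_ne_zero]
    intro h0
    exact nonZeroDivisors.coe_ne_zero y (hfA (by simpa using h0))
  have hunit' : ∀ y : nonZeroDivisors A, IsUnit (fA y) := by
    intro y
    rw [isUnit_iff_ne_zero]
    intro h0
    exact nonZeroDivisors.coe_ne_zero y (hfA (by simpa using h0))
  let f : K →+* L := IsLocalization.lift (M := nonZeroDivisors A) (g := fA.toRingHom) hunit'
  let h : K →+* TrivSqZeroExt L L := IsLocalization.lift (M := nonZeroDivisors A) (g := hA.toRingHom) hunit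
  have hfa : ∀ x, f (algebraMap A K x) = fA x := fun x => IsLocalization.lift_eq _ x
  have hha : ∀ x, h (algebraMap A K x) = hA x := fun x => IsLocalization.lift_eq _ x
  let π : TrivSqZeroExt L L →+* L := (TrivSqZeroExt.fstHom L L L).toRingHom
  have hπf : π.comp h = f := by
    apply IsLocalization.ringHom_ext (nonZeroDivisors A)
    ext x
    · simp only [RingHom.comp_apply, hfa, hha]
      exact hfst _
    · simp only [RingHom.comp_apply, hfa, hha]
      exact hfst _
  have : CharZero A := charZero_of_injective_algebraMap (algebraMap k A).injective
  have : CharZero K := charZero_of_injective_algebraMap (IsFractionRing.injective A K)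
  have hess : @Algebra.EssFiniteType K L _ _ f.toAlgebra := by
    let := f.toAlgebra
    have : IsScalarTower k K L := IsScalarTower.of_algebraMap_eq fun c => by
      change _ = f _
      rw [IsScalarTower.algebraMap_apply k A K, hfa, AlgHom.commutes]
    have : Algebra.EssFiniteType (MvPolynomial ι k) L := Algebra.EssFiniteType.of_isLocalization _ (nonZeroDivisors (MvPolynomial ι k))
    have : Algebra.EssFiniteType k L := Algebra.EssFiniteType.comp k (MvPolynomial ι k) L
    exact Algebra.EssFiniteType.of_comp k K L
  have hker : IsNilpotent (RingHom.ker π) := by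
    refine ⟨2, ?_⟩
    refine le_bot_iff.mp ((pow_two (RingHom.ker π)).le.trans <| Ideal.mul_le.mpr fun x hx y hy => ?_)
    have hx' : x.fst = 0 := hx
    have hy' : y.fst = 0 := hy
    rw [Ideal.mem_bot]
    ext <;> simp [hx', hy']
  -- The ε-part of `s` is a derivation of `L` extending the one that `v` defines on `K`; its values
  -- on the variables are the required `w`.
  obtain ⟨s, hs1, hs2⟩ := exists_section_of_charZero f h π hπf
    TrivSqZeroExt.fst_surjective hker hess
  have hsA : ∀ x, s (fA x) = hA x := fun x => by
    rw [← hfa, ← hha]; exact RingHom.congr_fun hs2 _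
  have hsfst : ∀ x, (s x).fst = x := fun x => RingHom.congr_fun hs1 x
  let sB : MvPolynomial ι k →ₐ[k] TrivSqZeroExt L L := ⟨s.comp (algebraMap (MvPolynomial ι k) L), fun c => by
    have := hsA (algebraMap k A c)
    rw [AlgHom.commutes, AlgHom.commutes] at this
    rw [IsScalarTower.algebraMap_apply k (MvPolynomial ι k) L] at this
    exact this⟩
  refine ⟨fun i => (s (algebraMap (MvPolynomial ι k) L (X i))).snd, fun t => ?_⟩
  have e1 : sB = aeval (fun i => TrivSqZeroExt.inl (algebraMap (MvPolynomial ι k) L (X i)) +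
      TrivSqZeroExt.inr (s (algebraMap (MvPolynomial ι k) L (X i))).snd) := by
    ext i
    · simp [sB, hsfst]
    · simp [sB]
  have e2 : sB (φ t) = TrivSqZeroExt.inl (a t) + TrivSqZeroExt.inr (v t) := by
    have := hsA (Ideal.Quotient.mk I (X t))
    have h3 : fA (Ideal.Quotient.mk I (X t)) = a t := aeval_X _ _
    have h4 : hA (Ideal.Quotient.mk I (X t)) =
      TrivSqZeroExt.inl (a t) + TrivSqZeroExt.inr (v t) := aeval_X _ _
    rw [h3, h4] at this
    exact this
  rw [e1, aeval_inl_add_inr] at e2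
  have e3 := congrArg TrivSqZeroExt.snd e2
  simp only [TrivSqZeroExt.snd_add, TrivSqZeroExt.snd_inl, TrivSqZeroExt.snd_inr, zero_add] at e3
  rw [← e3]
  refine Finset.sum_congr rfl fun i _ => ?_
  congr 1
  have := aeval_algebraMap_apply (R := k) L (X : ι → MvPolynomial ι k) (pderiv i (φ t))
  rw [aeval_X_left_apply] at this
  exact this

/-! ### Chevalley's theorem and generic points of an image -/

/-- A constructible set contains a relative neighbourhood of each of its points `x` in the closure
of `x`. -/
theorem Topology.IsConstructible.exists_isOpen_inter_closure_subset {T : Type*} [TopologicalSpace T]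
    {s : Set T} (hs : Topology.IsConstructible s) {x : T} (hx : x ∈ s) :
    ∃ U, IsOpen U ∧ x ∈ U ∧ U ∩ closure {x} ⊆ s := by
  -- The claim is proved for `s` and its complement together, so that the induction passes through
  -- complements.
  suffices h : ∀ x, (x ∈ s → ∃ U, IsOpen U ∧ x ∈ U ∧ U ∩ closure {x} ⊆ s) ∧
      (x ∉ s → ∃ U, IsOpen U ∧ x ∈ U ∧ U ∩ closure {x} ⊆ sᶜ) from (h x).1 hx
  clear hx x
  induction hs using Topology.IsConstructible.empty_union_induction with
  | open_retrocompact U hU _ =>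
    refine fun x => ⟨fun hx => ⟨U, hU, hx, Set.inter_subset_left⟩, fun hx =>
      ⟨Set.univ, isOpen_univ, trivial, ?_⟩⟩
    rw [Set.univ_inter]
    exact closure_minimal (by simpa using hx) hU.isClosed_compl
  | union s _ t _ hs ht =>
    refine fun x => ⟨?_, fun hx => ?_⟩
    · rintro (hx | hx)
      · obtain ⟨U, h1, h2, h3⟩ := (hs x).1 hx
        exact ⟨U, h1, h2, h3.trans Set.subset_union_left⟩
      · obtain ⟨U, h1, h2, h3⟩ := (ht x).1 hx
        exact ⟨U, h1, h2, h3.trans Set.subset_union_right⟩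
    · obtain ⟨U, h1, h2, h3⟩ := (hs x).2 fun h => hx (Or.inl h)
      obtain ⟨V, h4, h5, h6⟩ := (ht x).2 fun h => hx (Or.inr h)
      refine ⟨U ∩ V, h1.inter h4, ⟨h2, h5⟩, ?_⟩
      rintro y ⟨⟨hyU, hyV⟩, hy⟩ (h | h)
      · exact h3 ⟨hyU, hy⟩ h
      · exact h6 ⟨hyV, hy⟩ h
  | compl s _ hs =>
    exact fun x => ⟨(hs x).2, fun hx => by simpa using (hs x).1 (by simpa using hx)⟩

/-- A point outside a suitable hypersurface which satisfies all relations between the `φ t` is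
the image of a point at which `b` does not vanish. -/
theorem exists_preimage_of_generic {ι τ : Type*} [Finite ι] [Finite τ] {k : Type*} [Field k]
    [IsAlgClosed k] (φ : τ → MvPolynomial ι k) (b : MvPolynomial ι k) (hb : b ≠ 0) :
    ∃ Q : MvPolynomial τ k, aeval φ Q ≠ 0 ∧ ∀ y : τ → k,
      (∀ P : MvPolynomial τ k, aeval φ P = 0 → eval y P = 0) → eval y Q ≠ 0 →
      ∃ g : ι → k, eval g b ≠ 0 ∧ ∀ t, eval g (φ t) = y t := by
  let f : MvPolynomial τ k →+* MvPolynomial ι k := (aeval φ : _ →ₐ[k] _).toRingHom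
  have hf : f.FinitePresentation := by
    rw [← RingHom.FinitePresentation.of_finiteType]
    refine RingHom.FiniteType.of_comp_finiteType (f := (C : k →+* MvPolynomial τ k)) ?_
    have h1 : f.comp C = algebraMap k (MvPolynomial ι k) := by
      ext c : 1
      exact (aeval φ : MvPolynomial τ k →ₐ[k] _).commutes c
    rw [h1, RingHom.finiteType_algebraMap]
    infer_instance
  have hc := PrimeSpectrum.isConstructible_comap_image hf
    (PrimeSpectrum.isRetrocompact_basicOpen.isConstructible
      (PrimeSpectrum.basicOpen b).isOpen)
  let x₀ : PrimeSpectrum (MvPolynomial ι k) := ⟨⊥, Ideal.isPrime_bot⟩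
  have hx : PrimeSpectrum.comap f x₀ ∈
      PrimeSpectrum.comap f '' (PrimeSpectrum.basicOpen b : Set (PrimeSpectrum _)) :=
    ⟨x₀, by simpa [x₀, PrimeSpectrum.mem_basicOpen] using hb, rfl⟩
  obtain ⟨U, hU, hxU, hsub⟩ := hc.exists_isOpen_inter_closure_subset hx
  obtain ⟨_, ⟨Q, rfl⟩, hQ, hQU⟩ :=
    PrimeSpectrum.isTopologicalBasis_basic_opens.exists_subset_of_mem_open hxU hU
  refine ⟨Q, fun h0 => hQ (by change f Q = 0; exact h0), fun y hy hyQ => ?_⟩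
  let m : PrimeSpectrum (MvPolynomial τ k) := ⟨RingHom.ker (eval y), RingHom.ker_isPrime _⟩
  -- The closure of the image of the generic point is the zero locus of the relations, so it
  -- contains the point `y`.
  have hm : m ∈ U ∩ closure {PrimeSpectrum.comap f x₀} := by
    refine ⟨hQU hyQ, ?_⟩
    rw [PrimeSpectrum.closure_singleton, PrimeSpectrum.mem_zeroLocus]
    intro P hP
    exact hy P hP
  obtain ⟨q, hqb, hqm⟩ := hsub hm
  -- The prime `q` need not be maximal. The Nullstellensatz gives a closed point of its zero locus
  -- with `b` nonzero, and this point still lies over `y`.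
  have hq : b ∉ vanishingIdeal k (zeroLocus k q.asIdeal) := by
    rw [IsPrime.vanishingIdeal_zeroLocus]
    exact hqb
  simp only [mem_vanishingIdeal_iff, not_forall] at hq
  obtain ⟨g, hg, hgb⟩ := hq
  refine ⟨g, hgb, fun t => ?_⟩
  have h1 : X t - C (y t) ∈ (PrimeSpectrum.comap f q).asIdeal := by
    rw [hqm]
    change eval y _ = 0
    simp
  have h2 := hg _ h1
  have h3 : f (X t - C (y t)) = φ t - C (y t) := by simp [f]
  rw [h3] at h2
  exact sub_eq_zero.mp (by simpa [aeval_eq_eval] using h2)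

/-! ### Split exactness and the generic rank of the Jacobian -/

/-- If `t` inverts D on its range, then x − tDx lies in ker D and lifts through J. Such a
contracting identity, unlike exactness itself, survives clearing denominators and varying
parameters. -/
theorem LinearMap.exists_comp_add_comp_eq_id_of_ker_le_range {K U V W : Type*} [Field K]
    [AddCommGroup U] [AddCommGroup V] [AddCommGroup W] [Module K U] [Module K V] [Module K W]
    (J : U →ₗ[K] V) (D : V →ₗ[K] W) (h : LinearMap.ker D ≤ LinearMap.range J) :
    ∃ (s : V →ₗ[K] U) (t : W →ₗ[K] V), J ∘ₗ s + t ∘ₗ D = LinearMap.id := by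
  obtain ⟨r, hr⟩ := D.rangeRestrict.exists_rightInverse_of_surjective D.range_rangeRestrict
  obtain ⟨t, ht⟩ := r.exists_extend
  have htD : ∀ x, D (t (D x)) = D x := by
    intro x
    have h1 : t (D x) = r (D.rangeRestrict x) := LinearMap.congr_fun ht (D.rangeRestrict x)
    rw [h1]
    exact congrArg Subtype.val (LinearMap.congr_fun hr (D.rangeRestrict x))
  obtain ⟨q, hq⟩ := J.rangeRestrict.exists_rightInverse_of_surjective J.range_rangeRestrict
  have hmem : ∀ x, (LinearMap.id (R := K) (M := V) - t ∘ₗ D) x ∈ LinearMap.range J :=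
    fun x => h (by simp [htD])
  refine ⟨q ∘ₗ LinearMap.codRestrict _ _ hmem, t, ?_⟩
  ext x
  have h2 := congrArg Subtype.val (LinearMap.congr_fun hq (LinearMap.codRestrict _ _ hmem x))
  have h3 : J (q (LinearMap.codRestrict _ _ hmem x)) = x - t (D x) := h2
  simp [h3]

/-- If a complex of matrices over a domain is exact over the fraction field, then a nonzero
multiple of the identity is a sum of two matrices which factor through the two maps. -/
theorem Matrix.exists_mul_add_mul_eq_smul_one {R L ι τ υ : Type*} [CommRing R] [IsDomain R]
    [Field L] [Algebra R L] [IsFractionRing R L] [Fintype ι] [Fintype τ] [Fintype υ]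
    [DecidableEq τ] (J : Matrix τ ι R) (D : Matrix υ τ R)
    (h : ∀ v : τ → L, (D.map (algebraMap R L)).mulVec v = 0 →
      ∃ w, (J.map (algebraMap R L)).mulVec w = v) :
    ∃ (b : R) (s : Matrix ι τ R) (t : Matrix τ υ R), b ≠ 0 ∧ J * s + t * D = b • 1 := by
  classical
  obtain ⟨s, t, hst⟩ := LinearMap.exists_comp_add_comp_eq_id_of_ker_le_range
    (Matrix.toLin' (J.map (algebraMap R L))) (Matrix.toLin' (D.map (algebraMap R L))) (by
      intro v hv
      obtain ⟨w, hw⟩ := h v (by simpa using hv)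
      exact ⟨w, by simpa using hw⟩)
  obtain ⟨b, hb⟩ := IsLocalization.exist_integer_multiples_of_finite (nonZeroDivisors R)
    (Sum.elim (fun x : ι × τ => LinearMap.toMatrix' s x.1 x.2)
      (fun x : τ × υ => LinearMap.toMatrix' t x.1 x.2))
  have hb1 : ∀ i u, ∃ c, algebraMap R L c = algebraMap R L b * LinearMap.toMatrix' s i u :=
    fun i u => by
      obtain ⟨c, hc⟩ := hb (Sum.inl (i, u))
      exact ⟨c, by rw [hc, Algebra.smul_def]; rfl⟩
  have hb2 : ∀ i u, ∃ c, algebraMap R L c = algebraMap R L b * LinearMap.toMatrix' t i u :=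
    fun i u => by
      obtain ⟨c, hc⟩ := hb (Sum.inr (i, u))
      exact ⟨c, by rw [hc, Algebra.smul_def]; rfl⟩
  choose s' hs' using hb1
  choose t' ht' using hb2
  refine ⟨b, s', t', nonZeroDivisors.coe_ne_zero b, ?_⟩
  have hs : Matrix.map s' (algebraMap R L) = algebraMap R L b • LinearMap.toMatrix' s := by
    ext i u; exact hs' i u
  have ht : Matrix.map t' (algebraMap R L) = algebraMap R L b • LinearMap.toMatrix' t := by
    ext i u; exact ht' i u
  have h1 := congrArg LinearMap.toMatrix' hst
  rw [map_add, LinearMap.toMatrix'_comp, LinearMap.toMatrix'_comp, LinearMap.toMatrix'_id,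
    LinearMap.toMatrix'_toLin', LinearMap.toMatrix'_toLin'] at h1
  apply Matrix.map_injective (IsFractionRing.injective R L)
  change Matrix.map (J * Matrix.of s' + Matrix.of t' * D) _ = _
  rw [Matrix.map_add _ (map_add _), Matrix.map_mul, Matrix.map_mul]
  erw [hs, ht]
  rw [Matrix.mul_smul, Matrix.smul_mul, ← smul_add, h1]
  ext x y
  by_cases hxy : x = y <;> simp [hxy]

theorem eval_aeval_eq {ι τ k : Type*} [CommRing k] (φ : τ → MvPolynomial ι k) (g : ι → k)
    (P : MvPolynomial τ k) : eval g (aeval φ P) = eval (fun t => eval g (φ t)) P := by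
  induction P using MvPolynomial.induction_on with
  | C r => simp
  | add p q hp hq => simp only [map_add, hp, hq]
  | mul_X p j hp => simp only [map_mul, hp, aeval_X, eval_X]

/-- At a generic point of the parameter space, the common kernel of the differentials of all
relations between the `φ t` is the image of the differential of `φ`. -/
theorem exists_generic_tangent {ι τ : Type*} [Fintype ι] [Fintype τ] {k : Type*} [Field k]
    [CharZero k] (φ : τ → MvPolynomial ι k) :
    ∃ b : MvPolynomial ι k, b ≠ 0 ∧ ∀ g : ι → k, eval g b ≠ 0 → ∀ v : τ → k,
      (∀ P : MvPolynomial τ k, aeval φ P = 0 →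
        ∑ t, eval (fun t => eval g (φ t)) (pderiv t P) * v t = 0) →
      ∃ w : ι → k, ∀ t, v t = ∑ i, eval g (pderiv i (φ t)) * w i := by
  classical
  let L := FractionRing (MvPolynomial ι k)
  let am : MvPolynomial ι k →+* L := algebraMap _ L
  let row : MvPolynomial τ k → (τ → L) := fun P t => am (aeval φ (pderiv t P))
  let S : Set (τ → L) := row '' {P | aeval φ P = 0}
  -- Finitely many relations suffice, because their gradients span a subspace of a
  -- finite-dimensional space.
  obtain ⟨T, hTS, hT⟩ := Submodule.fg_span_iff_fg_span_finset_subset S |>.mp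
    (IsNoetherian.noetherian (Submodule.span L S))
  have hP : ∀ u : T, ∃ P, aeval φ P = 0 ∧ row P = u := fun u => hTS u.2
  choose P hP0 hProw using hP
  let J : Matrix τ ι (MvPolynomial ι k) := Matrix.of fun t i => pderiv i (φ t)
  let D : Matrix T τ (MvPolynomial ι k) := Matrix.of fun u t => aeval φ (pderiv t (P u))
  have hDJ : ∀ v : τ → L, (D.map am).mulVec v = 0 → ∃ w, (J.map am).mulVec w = v := by
    intro v hv
    have hv1 : ∀ u : T, ∑ t, (u : τ → L) t * v t = 0 := by
      intro u
      have := congrFun hv u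
      rw [← hProw]
      simpa [D, Matrix.mulVec, dotProduct, row] using this
    have hv2 : ∀ x ∈ Submodule.span L S, ∑ t, x t * v t = 0 := by
      rw [hT]
      intro x hx
      induction hx using Submodule.span_induction with
      | mem x hx => exact hv1 ⟨x, hx⟩
      | zero => simp
      | add x y _ _ hx hy => simp [add_mul, Finset.sum_add_distrib, hx, hy]
      | smul c x _ hx => simp [mul_assoc, ← Finset.mul_sum, hx]
    obtain ⟨w, hw⟩ := exists_tangent_lift φ L v
      (fun Q hQ => hv2 (row Q) (Submodule.subset_span ⟨Q, hQ, rfl⟩))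
    exact ⟨w, by ext t; simp [J, Matrix.mulVec, dotProduct, hw, am]⟩
  obtain ⟨b, s', t', hb0, hst⟩ := Matrix.exists_mul_add_mul_eq_smul_one J D hDJ
  have key : ∀ x y : τ, ∑ i, pderiv i (φ x) * s' i y +
      ∑ u, t' x u * aeval φ (pderiv y (P u)) = if x = y then b else 0 := by
    intro x y
    have := congrFun (congrFun hst x) y
    simpa [J, D, Matrix.mul_apply, Matrix.one_apply] using this
  refine ⟨b, hb0, fun g hg v hv => ?_⟩
  -- Evaluating J s' + t' D = b·1 at `g` and applying it to `v`, which D kills, gives b(g)v =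
  -- J(s'v).
  refine ⟨fun i => (eval g b)⁻¹ * ∑ y, eval g (s' i y) * v y, fun x => ?_⟩
  have hD : ∀ u, ∑ y, eval g (aeval φ (pderiv y (P u))) * v y = 0 := by
    intro u
    rw [← hv (P u) (hP0 u)]
    refine Finset.sum_congr rfl fun y _ => ?_
    rw [eval_aeval_eq]
  have hkey : ∀ y, ∑ i, eval g (pderiv i (φ x)) * eval g (s' i y) +
      ∑ u, eval g (t' x u) * eval g (aeval φ (pderiv y (P u))) =
      if x = y then eval g b else 0 := by
    intro y
    have := congrArg (eval g) (key x y)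
    simpa only [map_add, map_sum, map_mul, apply_ite (eval g), map_zero] using this
  have h1 : ∑ y, (∑ i, eval g (pderiv i (φ x)) * eval g (s' i y) +
      ∑ u, eval g (t' x u) * eval g (aeval φ (pderiv y (P u)))) * v y = eval g b * v x := by
    simp only [hkey]
    simp
  have h2 : ∑ y, (∑ u, eval g (t' x u) * eval g (aeval φ (pderiv y (P u)))) * v y = 0 := by
    simp only [Finset.sum_mul]
    rw [Finset.sum_comm]
    refine Finset.sum_eq_zero fun u _ => ?_
    simp only [mul_assoc]
    rw [← Finset.mul_sum, hD, mul_zero]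
  simp only [add_mul, Finset.sum_add_distrib] at h1
  rw [h2, add_zero] at h1
  have h3 : v x = (eval g b)⁻¹ * (eval g b * v x) := by field_simp
  rw [h3, ← h1, Finset.mul_sum]
  simp only [Finset.sum_mul, Finset.mul_sum]
  rw [Finset.sum_comm]
  exact Finset.sum_congr rfl fun i _ => Finset.sum_congr rfl fun y _ => by ring

/-! ### Openness of exactness -/

/-- The algebra of polynomial functions on `ι → k`. -/
noncomputable def polyFunctions (ι k : Type*) [Field k] : Subalgebra k ((ι → k) → k) :=
  (aeval (fun i (g : ι → k) => g i) : MvPolynomial ι k →ₐ[k] _).range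

theorem mem_polyFunctions_iff {ι k : Type*} [Field k] {f : (ι → k) → k} :
    f ∈ polyFunctions ι k ↔ ∃ P : MvPolynomial ι k, ∀ g, f g = eval g P := by
  have h : ∀ (P : MvPolynomial ι k) (g : ι → k),
      aeval (fun i (g : ι → k) => g i) P g = eval g P := by
    intro P g
    induction P using MvPolynomial.induction_on with
    | C r => simp
    | add p q hp hq => simp [hp, hq]
    | mul_X p j hp => simp [hp]
  constructor
  · rintro ⟨P, rfl⟩
    exact ⟨P, h P⟩
  · rintro ⟨P, hP⟩
    exact ⟨P, funext fun g => (h P g).trans (hP g).symm⟩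

/-- Exactness of a complex depending polynomially on parameters is an open condition. -/
theorem exists_generic_exact {ι k U V W : Type*} [Field k]
    [AddCommGroup U] [AddCommGroup V] [AddCommGroup W] [Module k U] [Module k V] [Module k W]
    [FiniteDimensional k V] (K : (ι → k) → U →ₗ[k] V) (D : (ι → k) → V →ₗ[k] W)
    (hK : ∀ u (l : Module.Dual k V), (fun g => l (K g u)) ∈ polyFunctions ι k)
    (hD : ∀ v (l : Module.Dual k W), (fun g => l (D g v)) ∈ polyFunctions ι k)
    (hDK : ∀ g, D g ∘ₗ K g = 0) (g₀ : ι → k)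
    (h : LinearMap.ker (D g₀) ≤ LinearMap.range (K g₀)) :
    ∃ b : MvPolynomial ι k, eval g₀ b ≠ 0 ∧ ∀ g, eval g b ≠ 0 →
      LinearMap.ker (D g) ≤ LinearMap.range (K g) := by
  obtain ⟨s, t, hst⟩ := (K g₀).exists_comp_add_comp_eq_id_of_ker_le_range (D g₀) h
  -- With `s` and `t` fixed, `N g₀` is the identity; `b` will be the determinant of `N`. Since D ∘ K
  -- = 0, `N g` preserves ker (D g) and equals K g ∘ s there, so invertibility of `N g` gives
  -- exactness at `g`.
  let N : (ι → k) → V →ₗ[k] V := fun g => K g ∘ₗ s + t ∘ₗ D g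
  let bs := Module.finBasis k V
  have hN : (fun g => LinearMap.det (N g)) ∈ polyFunctions ι k := by
    have h1 : (fun g => LinearMap.det (N g)) = ∑ σ : Equiv.Perm (Fin (Module.finrank k V)),
        Equiv.Perm.sign σ • ∏ i, fun g => bs.coord (σ i) (N g (bs i)) := by
      ext g
      rw [← LinearMap.det_toMatrix bs, Matrix.det_apply]
      simp [LinearMap.toMatrix_apply, Finset.sum_apply, Finset.prod_apply]
    rw [h1]
    refine Subalgebra.sum_mem _ fun σ _ => ?_
    rw [Units.smul_def]
    refine Subalgebra.zsmul_mem _ (Subalgebra.prod_mem _ fun i _ => ?_) _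
    convert Subalgebra.add_mem _ (hK (s (bs i)) (bs.coord (σ i)))
      (hD (bs i) (bs.coord (σ i) ∘ₗ t)) using 1
    ext g
    simp [N]
  obtain ⟨b, hb⟩ := mem_polyFunctions_iff.mp hN
  refine ⟨b, ?_, fun g hg v hv => ?_⟩
  · rw [← hb]
    simp [N, hst]
  · rw [← hb] at hg
    have hinj : Function.Injective (N g) :=
      (LinearEquiv.ofIsUnitDet (f := N g) (v := bs) (v' := bs)
        (by rw [LinearMap.det_toMatrix]; exact isUnit_iff_ne_zero.mpr hg)).injective
    have hmaps : ∀ x ∈ LinearMap.ker (D g), N g x ∈ LinearMap.ker (D g) := by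
      intro x hx
      have h2 : D g (K g (s x)) = 0 := LinearMap.congr_fun (hDK g) (s x)
      simp [N, LinearMap.mem_ker.mp hx, h2]
    have hsurj : Function.Surjective ((N g).restrict hmaps) :=
      LinearMap.injective_iff_surjective.mp fun x y hxy =>
        Subtype.ext (hinj (congrArg Subtype.val hxy))
    obtain ⟨x, hx⟩ := hsurj ⟨v, hv⟩
    have h3 : N g x = v := congrArg Subtype.val hx
    refine ⟨s x, ?_⟩
    rw [← h3]
    simp [N, LinearMap.mem_ker.mp x.2]

/-! ### Coordinates on forms and the sum-of-squares map -/

/-- The exponent vectors of the monomials of degree `k` in `x₀, …, xₙ`. -/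
abbrev Exponent (n k : ℕ) : Type :=
  ↥(Finset.finsuppAntidiag (Finset.univ : Finset (Fin (n + 1))) k)

theorem Exponent.degree_eq {n k : ℕ} (e : Exponent n k) :
    (e : Fin (n + 1) →₀ ℕ).degree = k := by
  rw [Finsupp.degree_eq_sum]
  exact (Finset.mem_finsuppAntidiag.mp e.2).1

/-- The exponent vector `m` of degree `k`. -/
def Exponent.mk {n k : ℕ} (m : Fin (n + 1) →₀ ℕ) (hm : m.degree = k) : Exponent n k :=
  ⟨m, Finset.mem_finsuppAntidiag.mpr ⟨by rw [← hm, Finsupp.degree_eq_sum], Finset.subset_univ _⟩⟩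

/-- A monomial as a form. -/
noncomputable def monomialForm {n k : ℕ} (e : Exponent n k) : Form n k :=
  ⟨monomial e 1, isHomogeneous_monomial _ e.degree_eq⟩

theorem coe_monomialForm {n k : ℕ} (e : Exponent n k) :
    (monomialForm e : MvPolynomial (Fin (n + 1)) ℂ) = monomial (e : Fin (n + 1) →₀ ℕ) 1 := rfl

theorem Form.ext_coeff {n k : ℕ} {p q : Form n k}
    (h : ∀ m : Fin (n + 1) →₀ ℕ, m.degree = k →
      coeff m (p : MvPolynomial (Fin (n + 1)) ℂ) = coeff m (q : MvPolynomial (Fin (n + 1)) ℂ)) :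
    p = q := by
  apply Subtype.ext
  ext m
  by_cases hm : m.degree = k
  · exact h m hm
  · rw [IsHomogeneous.coeff_eq_zero p.2 hm, IsHomogeneous.coeff_eq_zero q.2 hm]

instance Form.finiteDimensional (n k : ℕ) : FiniteDimensional ℂ (Form n k) := by
  let F : Form n k →ₗ[ℂ] (Exponent n k → ℂ) :=
    LinearMap.pi fun e => lcoeff ℂ (e : Fin (n + 1) →₀ ℕ) ∘ₗ Submodule.subtype _
  refine Module.Finite.of_injective F fun p q h => Form.ext_coeff fun m hm => ?_
  exact congrFun h (Exponent.mk m hm)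

/-- The tuple of forms with given coefficients. -/
noncomputable def tupleOfCoeffs {n k r : ℕ} (g : Fin r × Exponent n k → ℂ) (i : Fin r) :
    Form n k :=
  ∑ e, g (i, e) • monomialForm e

theorem coe_tupleOfCoeffs {n k r : ℕ} (g : Fin r × Exponent n k → ℂ) (i : Fin r) :
    (tupleOfCoeffs g i : MvPolynomial (Fin (n + 1)) ℂ) =
      ∑ e : Exponent n k, monomial (e : Fin (n + 1) →₀ ℕ) (g (i, e)) := by
  simp [tupleOfCoeffs, coe_monomialForm, smul_monomial]

theorem tupleOfCoeffs_coeff {n k r : ℕ} (g : Fin r → Form n k) :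
    tupleOfCoeffs (fun x => coeff (x.2 : Fin (n + 1) →₀ ℕ)
      (g x.1 : MvPolynomial (Fin (n + 1)) ℂ)) = g := by
  funext i
  refine Form.ext_coeff fun m hm => ?_
  rw [coe_tupleOfCoeffs, coeff_sum, Finset.sum_eq_single (Exponent.mk m hm)]
  · simp [Exponent.mk]
  · intro e _ he
    rw [coeff_monomial, if_neg]
    exact fun h => he (Subtype.ext h)
  · simp

theorem coeff_tupleOfCoeffs_mul {n k r : ℕ} (g w : Fin r × Exponent n k → ℂ) (i : Fin r)
    (m : Fin (n + 1) →₀ ℕ) :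
    coeff m (tupleOfCoeffs g i * tupleOfCoeffs w i : MvPolynomial (Fin (n + 1)) ℂ) =
      ∑ e : Exponent n k, ∑ e' : Exponent n k,
        if (e + e' : Fin (n + 1) →₀ ℕ) = m then g (i, e) * w (i, e') else 0 := by
  simp only [coe_tupleOfCoeffs, Finset.sum_mul_sum, coeff_sum, monomial_mul, coeff_monomial]

/-- The coefficients of a sum of `r` squares as polynomials in the coefficients of the summands. -/
noncomputable def sumSqCoeff (n k r : ℕ) (m : Fin (n + 1) →₀ ℕ) :
    MvPolynomial (Fin r × Exponent n k) ℂ :=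
  ∑ i, ∑ e : Exponent n k, ∑ e' : Exponent n k,
    if (e + e' : Fin (n + 1) →₀ ℕ) = m then X (i, e) * X (i, e') else 0

theorem eval_sumSqCoeff {n k r : ℕ} (g : Fin r × Exponent n k → ℂ) (m : Fin (n + 1) →₀ ℕ) :
    eval g (sumSqCoeff n k r m) =
      coeff m (∑ i, (tupleOfCoeffs g i : MvPolynomial (Fin (n + 1)) ℂ) ^ 2) := by
  simp only [sumSqCoeff, pow_two, coeff_sum, coeff_tupleOfCoeffs_mul, map_sum,
    apply_ite (eval g), map_mul, eval_X, map_zero]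

/-- This is the product rule d(∑ gᵢ²) = 2 ∑ gᵢ dgᵢ, which identifies tangent directions with
elements of the ideal of the gᵢ. -/
theorem sum_eval_pderiv_sumSqCoeff {n k r : ℕ} (g w : Fin r × Exponent n k → ℂ)
    (m : Fin (n + 1) →₀ ℕ) :
    ∑ x, eval g (pderiv x (sumSqCoeff n k r m)) * w x =
      coeff m (∑ i, 2 * (tupleOfCoeffs g i * tupleOfCoeffs w i :
        MvPolynomial (Fin (n + 1)) ℂ)) := by
  have h1 : ∀ a b : Fin r × Exponent n k,
      ∑ x, eval g (pderiv x (X a * X b)) * w x = g a * w b + w a * g b := by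
    intro a b
    simp [pderiv_X, Pi.single_apply, add_mul, Finset.sum_add_distrib, apply_ite (eval g)]
    ring
  have h2 : ∑ x, eval g (pderiv x (sumSqCoeff n k r m)) * w x =
      ∑ i, ∑ e : Exponent n k, ∑ e' : Exponent n k,
        if (e + e' : Fin (n + 1) →₀ ℕ) = m then g (i, e) * w (i, e') + w (i, e) * g (i, e')
        else 0 := by
    simp only [sumSqCoeff, map_sum, Finset.sum_mul]
    rw [Finset.sum_comm]
    refine Finset.sum_congr rfl fun i _ => ?_
    rw [Finset.sum_comm]
    refine Finset.sum_congr rfl fun e _ => ?_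
    rw [Finset.sum_comm]
    refine Finset.sum_congr rfl fun e' _ => ?_
    split_ifs with h
    · exact h1 _ _
    · simp
  rw [h2, coeff_sum]
  refine Finset.sum_congr rfl fun i _ => ?_
  rw [two_mul, coeff_add]
  nth_rewrite 2 [mul_comm]
  rw [coeff_tupleOfCoeffs_mul, coeff_tupleOfCoeffs_mul, ← Finset.sum_add_distrib]
  refine Finset.sum_congr rfl fun e _ => ?_
  rw [← Finset.sum_add_distrib]
  refine Finset.sum_congr rfl fun e' _ => ?_
  split_ifs <;> simp

/-! ### The special tuple of pure powers -/

/-- The powers of the first `r` variables. -/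
noncomputable def powerForms {n k r : ℕ} (hr : r ≤ n + 1) (i : Fin r) : Form n k :=
  monomialForm (Exponent.mk (Finsupp.single (Fin.castLE hr i) k) (Finsupp.degree_single _ _))

theorem coe_powerForms {n k r : ℕ} (hr : r ≤ n + 1) (i : Fin r) :
    (powerForms (k := k) hr i : MvPolynomial (Fin (n + 1)) ℂ) =
      monomial (Finsupp.single (Fin.castLE hr i) k) 1 := rfl

theorem Finsupp.eq_single_of_degree_le {σ : Type*} [Fintype σ] {m : σ →₀ ℕ} {i : σ} {k : ℕ}
    (hm : m.degree = k) (hi : k ≤ m i) : m = Finsupp.single i k := by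
  classical
  rw [Finsupp.degree_eq_sum, ← Finset.add_sum_erase _ _ (Finset.mem_univ i)] at hm
  have h0 : ∑ j ∈ Finset.univ.erase i, m j = 0 := by omega
  rw [Finset.sum_eq_zero_iff] at h0
  ext j
  by_cases hj : j = i
  · subst hj
    rw [Finsupp.single_eq_same]
    omega
  · rw [Finsupp.single_eq_of_ne hj, h0 j (by simp [hj])]

theorem coeff_mul_powerForms {n k r : ℕ} (hr : r ≤ n + 1) (i : Fin r) (p : Form n k)
    (m : Fin (n + 1) →₀ ℕ) :
    coeff m (p * powerForms (k := k) hr i : MvPolynomial (Fin (n + 1)) ℂ) =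
      if k ≤ m (Fin.castLE hr i) then
        coeff (m - Finsupp.single (Fin.castLE hr i) k) (p : MvPolynomial (Fin (n + 1)) ℂ)
      else 0 := by
  rw [coe_powerForms, coeff_mul_monomial', mul_one]
  simp only [Finsupp.single_le_iff]

/-- A monomial of degree k in which some variable has exponent at least k is the pure power of that
variable. -/
theorem sum_smul_powerForms {n k r : ℕ} (hk : k ≠ 0) (hr : r ≤ n + 1) (p : Form n k)
    (hp : ∀ m : Fin (n + 1) →₀ ℕ, m.degree = k → (∀ i : Fin r, m (Fin.castLE hr i) < k) →
      coeff m (p : MvPolynomial (Fin (n + 1)) ℂ) = 0) :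
    p = ∑ i, coeff (Finsupp.single (Fin.castLE hr i) k) (p : MvPolynomial (Fin (n + 1)) ℂ) •
      powerForms hr i := by
  refine Form.ext_coeff fun m hm => ?_
  simp only [AddSubmonoidClass.coe_finsetSum, Submodule.coe_smul, coeff_sum, coeff_smul,
    coe_powerForms, coeff_monomial, smul_eq_mul, mul_ite, mul_one, mul_zero]
  by_cases h : ∀ i : Fin r, m (Fin.castLE hr i) < k
  · rw [hp m hm h, Finset.sum_eq_zero]
    intro i _
    rw [if_neg]
    rintro rfl
    simpa using h i
  · push Not at h
    obtain ⟨i, hi⟩ := h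
    rw [Finsupp.eq_single_of_degree_le hm hi, Finset.sum_eq_single i]
    · simp
    · intro j _ hj
      rw [if_neg]
      intro h
      have := DFunLike.congr_fun h (Fin.castLE hr j)
      rw [Finsupp.single_eq_same, Finsupp.single_eq_of_ne] at this
      · exact hk this
      · exact fun h => hj (Fin.castLE_injective hr h)
    · simp

/-- The syzygies of degree `k` of the powers `xᵢᵏ` are the Koszul syzygies. -/
theorem powerForms_syzygy {n k r : ℕ} (hk : k ≠ 0) (hr : r ≤ n + 1) (b : Fin r → Form n k)
    (hb : ∑ i, (b i * powerForms (k := k) hr i : MvPolynomial (Fin (n + 1)) ℂ) = 0) :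
    ∃ κ : Fin r → Fin r → ℂ, ∀ i, b i = ∑ j, (κ i j - κ j i) • powerForms hr j := by
  have hrel : ∀ m : Fin (n + 1) →₀ ℕ, ∑ l, (if k ≤ m (Fin.castLE hr l) then
      coeff (m - Finsupp.single (Fin.castLE hr l) k) (b l : MvPolynomial (Fin (n + 1)) ℂ)
      else 0) = 0 := by
    intro m
    have := congrArg (coeff m) hb
    simpa only [coeff_sum, coeff_mul_powerForms, coeff_zero] using this
  let β : Fin r → Fin r → ℂ := fun i j =>
    coeff (Finsupp.single (Fin.castLE hr j) k) (b i : MvPolynomial (Fin (n + 1)) ℂ)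
  have hβ : ∀ i, b i = ∑ j, β i j • powerForms hr j := by
    intro i
    refine sum_smul_powerForms hk hr (b i) fun m hm hlt => ?_
    -- In the coefficient of m·xᵢᵏ only the summand `i` contributes, because the other relevant
    -- exponents stay below k.
    have h := hrel (m + Finsupp.single (Fin.castLE hr i) k)
    rw [Finset.sum_eq_single i] at h
    · simpa using h
    · intro l _ hl
      rw [if_neg]
      rw [Finsupp.add_apply, Finsupp.single_eq_of_ne
        (fun h => hl (Fin.castLE_injective hr h)), add_zero]
      exact not_le.mpr (hlt l)
    · simp
  have hanti : ∀ i j, β i j = -β j i := by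
    intro i j
    -- The coefficient of xᵢᵏxⱼᵏ yields antisymmetry of β; hence κ = β/2 at the end.
    have h := hrel (Finsupp.single (Fin.castLE hr j) k + Finsupp.single (Fin.castLE hr i) k)
    by_cases hij : i = j
    · subst hij
      rw [Finset.sum_eq_single i] at h
      · have : β i i = 0 := by simpa [β] using h
        rw [this, neg_zero]
      · intro l _ hl
        rw [if_neg]
        rw [Finsupp.add_apply, Finsupp.single_eq_of_ne
          (fun h => hl (Fin.castLE_injective hr h))]
        omega
      · simp
    · rw [Finset.sum_eq_add i j hij] at h
      · have h1 : β i j + β j i = 0 := by simpa [β] using h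
        exact eq_neg_of_add_eq_zero_left h1
      · rintro l _ ⟨hli, hlj⟩
        rw [if_neg]
        rw [Finsupp.add_apply, Finsupp.single_eq_of_ne
          (fun h => hli (Fin.castLE_injective hr h)), Finsupp.single_eq_of_ne
          (fun h => hlj (Fin.castLE_injective hr h))]
        omega
      · simp
      · simp
  refine ⟨fun i j => β i j / 2, fun i => (hβ i).trans (Finset.sum_congr rfl fun j _ => ?_)⟩
  congr 1
  simp only [hanti j i]
  ring

/-- If all multiples of degree `2k` of a form `p` of degree `k` lie in the ideal generated by the
powers `xᵢᵏ`, then `p` is a combination of these powers. -/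
theorem powerForms_saturated {n k r : ℕ} (hk : k ≠ 0) (hnk : 2 * k ≤ (n + 1) * (k - 1))
    (hr : r ≤ n + 1) (p : Form n k) (a : Exponent n k → Fin r → Form n k)
    (h : ∀ q : Exponent n k, (p * monomialForm q : MvPolynomial (Fin (n + 1)) ℂ) =
      ∑ i, (a q i * powerForms (k := k) hr i : MvPolynomial (Fin (n + 1)) ℂ)) :
    ∃ c : Fin r → ℂ, p = ∑ i, c i • powerForms hr i := by
  refine ⟨_, sum_smul_powerForms hk hr p fun m hm hlt => ?_⟩
  -- A monomial q of degree k is sought with m + q having exponents below k in the first r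
  -- variables. The available room is at least (n+1)(k−1) − k, which is at least k by `hnk`;
  -- truncated subtraction only increases it.
  obtain ⟨q, hq, hqk⟩ := Finsupp.exists_le_degree_eq
    (Finsupp.equivFunOnFinite.symm fun i => k - 1 - m i) k (by
    rw [Finsupp.degree_eq_sum]
    simp only [Finsupp.coe_equivFunOnFinite_symm]
    have h1 : ∑ i : Fin (n + 1), (k - 1) ≤ ∑ i, ((k - 1 - m i) + m i) :=
      Finset.sum_le_sum fun i _ => by omega
    rw [Finset.sum_add_distrib, ← Finsupp.degree_eq_sum, hm] at h1
    simp only [Finset.sum_const, Finset.card_univ, Fintype.card_fin, smul_eq_mul] at h1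
    omega)
  replace hq : ∀ i, q i ≤ k - 1 - m i := fun i => hq i
  -- None of the powers divides m·q, so the right-hand side has coefficient 0 there, while the
  -- left-hand side has the coefficient of p at m.
  have h2 := congrArg (coeff (m + q)) (h (Exponent.mk q hqk))
  rw [coe_monomialForm, coeff_sum, Finset.sum_eq_zero] at h2
  · have h3 := coeff_mul_monomial (R := ℂ) m q 1 (p : MvPolynomial (Fin (n + 1)) ℂ)
    rw [mul_one] at h3
    rw [← h3]
    exact h2
  · intro i _
    rw [coeff_mul_powerForms, if_neg]
    have h4 := hlt i
    have h5 := hq (Fin.castLE hr i)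
    rw [Finsupp.add_apply]
    omega

/-! ### Koszul syzygies and saturation for generic tuples -/

/-- A vector-valued function on `ι → k` all of whose coordinates are polynomial functions. -/
def IsPolynomialMap {ι k W : Type*} [Field k] [AddCommGroup W] [Module k W]
    (F : (ι → k) → W) : Prop :=
  ∀ l : Module.Dual k W, (fun g => l (F g)) ∈ polyFunctions ι k

namespace IsPolynomialMap

variable {ι k W W' : Type*} [Field k] [AddCommGroup W] [Module k W] [AddCommGroup W'] [Module k W']

theorem const (w : W) : IsPolynomialMap (fun _ : ι → k => w) := fun l =>
  Subalgebra.algebraMap_mem (polyFunctions ι k) (l w)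

theorem coord_smul (x : ι) (w : W) : IsPolynomialMap (fun g : ι → k => g x • w) := fun l =>
  mem_polyFunctions_iff.mpr ⟨X x * C (l w), fun g => by simp⟩

theorem add {F G : (ι → k) → W} (hF : IsPolynomialMap F) (hG : IsPolynomialMap G) :
    IsPolynomialMap (fun g => F g + G g) := fun l => by
  simp only [map_add]
  exact Subalgebra.add_mem _ (hF l) (hG l)

theorem map (L : W →ₗ[k] W') {F : (ι → k) → W} (hF : IsPolynomialMap F) :
    IsPolynomialMap (fun g => L (F g)) := fun l => hF (l ∘ₗ L)

theorem sum {α : Type*} (s : Finset α) {F : α → (ι → k) → W}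
    (hF : ∀ a, IsPolynomialMap (F a)) : IsPolynomialMap (fun g => ∑ a ∈ s, F a g) := fun l => by
  have : (fun g => l (∑ a ∈ s, F a g)) = ∑ a ∈ s, fun g => l (F a g) := by
    ext g
    simp
  rw [this]
  exact Subalgebra.sum_mem _ fun a _ => hF a l

theorem prodMk {F : (ι → k) → W} {G : (ι → k) → W'} (hF : IsPolynomialMap F)
    (hG : IsPolynomialMap G) : IsPolynomialMap (fun g => (F g, G g)) := by
  have := (hF.map (LinearMap.inl k W W')).add (hG.map (LinearMap.inr k W W'))
  simpa using this

theorem pi {α : Type*} [Finite α] {F : α → (ι → k) → W} (hF : ∀ a, IsPolynomialMap (F a)) :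
    IsPolynomialMap (fun g a => F a g) := by
  classical
  cases nonempty_fintype α
  have := IsPolynomialMap.sum Finset.univ
    fun a => (hF a).map (LinearMap.single k (fun _ : α => W) a)
  have e : (fun g a => F a g) =
      fun g => ∑ a, LinearMap.single k (fun _ : α => W) a (F a g) := by
    funext g a
    simp [Finset.sum_apply, Pi.single_apply]
  rw [e]
  exact this

end IsPolynomialMap

theorem isPolynomialMap_tupleOfCoeffs {n k r : ℕ} (i : Fin r) :
    IsPolynomialMap (fun g : Fin r × Exponent n k → ℂ => tupleOfCoeffs g i) :=
  IsPolynomialMap.sum _ fun _ => IsPolynomialMap.coord_smul _ _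

/-- The parametrization of the trivial solutions of `p * q = ∑ i, a q i * g i`, where `q` runs
over the monomials. -/
noncomputable def koszulMap {n k r : ℕ} (g : Fin r → Form n k) :
    ((Fin r → ℂ) × (Exponent n k → Fin r → Fin r → ℂ)) →ₗ[ℂ]
      (Form n k × (Exponent n k → Fin r → Form n k)) where
  toFun u := (∑ i, u.1 i • g i,
    fun q i => u.1 i • monomialForm q + ∑ j, (u.2 q i j - u.2 q j i) • g j)
  map_add' u v := by
    refine Prod.ext ?_ ?_
    · simp [add_smul, Finset.sum_add_distrib]
    · funext q i
      simp only [Prod.fst_add, Prod.snd_add, Pi.add_apply, add_sub_add_comm, add_smul,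
        Finset.sum_add_distrib]
      abel
  map_smul' c u := by
    refine Prod.ext ?_ ?_
    · simp [mul_smul, Finset.smul_sum]
    · funext q i
      simp [mul_smul, Finset.smul_sum, ← mul_sub]

/-- The map `(p, a) ↦ p * q - ∑ i, a q i * g i`, where `q` runs over the monomials. -/
noncomputable def syzygyMap {n k r : ℕ} (g : Fin r → Form n k) :
    (Form n k × (Exponent n k → Fin r → Form n k)) →ₗ[ℂ]
      (Exponent n k → MvPolynomial (Fin (n + 1)) ℂ) where
  toFun v q := v.1 * monomialForm q - ∑ i, (v.2 q i * g i : MvPolynomial (Fin (n + 1)) ℂ)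
  map_add' u v := by
    funext q
    simp only [Prod.fst_add, Prod.snd_add, Pi.add_apply, Submodule.coe_add, add_mul,
      Finset.sum_add_distrib]
    abel
  map_smul' c u := by
    funext q
    simp [Finset.smul_sum, smul_sub]

theorem syzygyMap_comp_koszulMap {n k r : ℕ} (g : Fin r → Form n k) :
    syzygyMap g ∘ₗ koszulMap g = 0 := by
  refine LinearMap.ext fun u => funext fun q => ?_
  have h : ∑ i, ∑ j, (u.2 q i j - u.2 q j i) •
      (g j * g i : MvPolynomial (Fin (n + 1)) ℂ) = 0 := by
    simp only [sub_smul, Finset.sum_sub_distrib]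
    rw [sub_eq_zero]
    nth_rewrite 2 [Finset.sum_comm]
    simp only [mul_comm]
  simp only [syzygyMap, koszulMap, LinearMap.comp_apply, LinearMap.coe_mk, AddHom.coe_mk,
    Submodule.coe_add, Submodule.coe_smul, AddSubmonoidClass.coe_finsetSum, add_mul,
    Finset.sum_add_distrib, Finset.sum_mul, smul_mul_assoc, h, LinearMap.zero_apply,
    Pi.zero_apply, add_zero]
  rw [sub_eq_zero]
  exact Finset.sum_congr rfl fun i _ => by rw [mul_comm]

/-- The linear combinations of the forms `g i`. -/
noncomputable def combinationMap {n k r : ℕ} (g : Fin r → Form n k) :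
    (Fin r → ℂ) →ₗ[ℂ] Form n k where
  toFun c := ∑ i, c i • g i
  map_add' u v := by simp [add_smul, Finset.sum_add_distrib]
  map_smul' c u := by simp [mul_smul, Finset.smul_sum]

/-- The forms `g i` are linearly independent, have only Koszul syzygies in their own degree, and
any form of that degree whose multiples lie in the ideal they generate is a combination of them. -/
def IsKoszulSaturated {n k r : ℕ} (g : Fin r → Form n k) : Prop :=
  LinearMap.ker (combinationMap g) = ⊥ ∧
    LinearMap.ker (syzygyMap g) ≤ LinearMap.range (koszulMap g)

theorem isKoszulSaturated_powerForms {n k r : ℕ} (hk : k ≠ 0)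
    (hnk : 2 * k ≤ (n + 1) * (k - 1)) (hr : r ≤ n + 1) :
    IsKoszulSaturated (powerForms (n := n) (k := k) hr) := by
  constructor
  · rw [LinearMap.ker_eq_bot']
    intro c hc
    funext i
    have h := congrArg (coeff (Finsupp.single (Fin.castLE hr i) k)) (congrArg Subtype.val hc)
    simp only [combinationMap, LinearMap.coe_mk, AddHom.coe_mk, AddSubmonoidClass.coe_finsetSum,
      Submodule.coe_smul, coeff_sum, coeff_smul, coe_powerForms, coeff_monomial, smul_eq_mul,
      mul_ite, mul_one, mul_zero, ZeroMemClass.coe_zero, coeff_zero] at h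
    rw [Finset.sum_eq_single i] at h
    · simpa using h
    · intro j _ hj
      rw [if_neg]
      intro h
      have := DFunLike.congr_fun h (Fin.castLE hr j)
      rw [Finsupp.single_eq_same, Finsupp.single_eq_of_ne] at this
      · exact hk this
      · exact fun h => hj (Fin.castLE_injective hr h)
    · simp
  · rintro ⟨p, a⟩ hpa
    have h : ∀ q : Exponent n k, (p * monomialForm q : MvPolynomial (Fin (n + 1)) ℂ) =
        ∑ i, (a q i * powerForms (k := k) hr i : MvPolynomial (Fin (n + 1)) ℂ) := fun q =>
      sub_eq_zero.mp (congrFun (LinearMap.mem_ker.mp hpa) q)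
    obtain ⟨c, hc⟩ := powerForms_saturated hk hnk hr p a h
    -- Once p = ∑ cᵢxᵢᵏ, subtracting the obvious solution cᵢq leaves a genuine syzygy of the powers.
    have hsyz : ∀ q, ∃ κ : Fin r → Fin r → ℂ, ∀ i,
        a q i - c i • monomialForm q = ∑ j, (κ i j - κ j i) • powerForms hr j := by
      intro q
      refine powerForms_syzygy hk hr (fun i => a q i - c i • monomialForm q) ?_
      simp only [Submodule.coe_sub, Submodule.coe_smul, sub_mul, Finset.sum_sub_distrib]
      rw [← h, sub_eq_zero, hc]
      simp only [AddSubmonoidClass.coe_finsetSum, Submodule.coe_smul, Finset.sum_mul,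
        smul_mul_assoc]
      exact Finset.sum_congr rfl fun i _ => by rw [mul_comm]
    choose κ hκ using hsyz
    refine ⟨(c, κ), Prod.ext hc.symm (funext fun q => funext fun i => ?_)⟩
    change c i • monomialForm q + ∑ j, (κ q i j - κ q j i) • powerForms hr j = a q i
    rw [← hκ]
    abel

theorem isPolynomialMap_combinationMap {n k r : ℕ} (c : Fin r → ℂ) :
    IsPolynomialMap (fun g : Fin r × Exponent n k → ℂ => combinationMap (tupleOfCoeffs g) c) :=
  IsPolynomialMap.sum Finset.univ fun i =>
    (isPolynomialMap_tupleOfCoeffs i).map (LinearMap.lsmul ℂ (Form n k) (c i))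

theorem isPolynomialMap_koszulMap {n k r : ℕ}
    (u : (Fin r → ℂ) × (Exponent n k → Fin r → Fin r → ℂ)) :
    IsPolynomialMap (fun g : Fin r × Exponent n k → ℂ => koszulMap (tupleOfCoeffs g) u) := by
  refine IsPolynomialMap.prodMk (isPolynomialMap_combinationMap u.1)
    (IsPolynomialMap.pi fun q => IsPolynomialMap.pi fun i => ?_)
  exact (IsPolynomialMap.const (u.1 i • monomialForm q)).add
    (isPolynomialMap_combinationMap fun j => u.2 q i j - u.2 q j i)

theorem isPolynomialMap_syzygyMap {n k r : ℕ}
    (v : Form n k × (Exponent n k → Fin r → Form n k)) :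
    IsPolynomialMap (fun g : Fin r × Exponent n k → ℂ => syzygyMap (tupleOfCoeffs g) v) := by
  refine IsPolynomialMap.pi fun q => ?_
  have h := (IsPolynomialMap.const (ι := Fin r × Exponent n k)
    (v.1 * monomialForm q : MvPolynomial (Fin (n + 1)) ℂ)).add
    (IsPolynomialMap.sum Finset.univ fun i => (isPolynomialMap_tupleOfCoeffs (k := k) i).map
      (LinearMap.mulLeft ℂ (-(v.2 q i : MvPolynomial (Fin (n + 1)) ℂ)) ∘ₗ
        (homogeneousSubmodule (Fin (n + 1)) ℂ k).subtype))
  have e : ∀ g : Fin r × Exponent n k → ℂ, syzygyMap (tupleOfCoeffs g) v q =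
      v.1 * monomialForm q + ∑ i, -(v.2 q i : MvPolynomial (Fin (n + 1)) ℂ) *
        tupleOfCoeffs g i := fun g => by
    simp [syzygyMap, sub_eq_add_neg]
  simp only [e]
  exact h

theorem exists_generic_isKoszulSaturated {n k r : ℕ} (hk : k ≠ 0)
    (hnk : 2 * k ≤ (n + 1) * (k - 1)) (hr : r ≤ n + 1) :
    ∃ b : MvPolynomial (Fin r × Exponent n k) ℂ, b ≠ 0 ∧ ∀ g, eval g b ≠ 0 →
      IsKoszulSaturated (tupleOfCoeffs g) := by
  obtain ⟨h1, h2⟩ := isKoszulSaturated_powerForms hk hnk hr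
  rw [← tupleOfCoeffs_coeff (powerForms (n := n) (k := k) hr)] at h1 h2
  set g₀ : Fin r × Exponent n k → ℂ := fun x => coeff (x.2 : Fin (n + 1) →₀ ℕ)
    (powerForms (k := k) hr x.1 : MvPolynomial (Fin (n + 1)) ℂ)
  -- Linear independence is treated as exactness, with the zero map as incoming arrow.
  obtain ⟨b₁, hb₁, hb₁'⟩ := exists_generic_exact
    (fun _ : Fin r × Exponent n k → ℂ => (0 : ℂ →ₗ[ℂ] (Fin r → ℂ)))
    (fun g => combinationMap (tupleOfCoeffs g))
    (fun _ l => IsPolynomialMap.const _ l) isPolynomialMap_combinationMap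
    (fun g => LinearMap.comp_zero _) g₀ (h1.le.trans bot_le)
  obtain ⟨b₂, hb₂, hb₂'⟩ := exists_generic_exact
    (fun g : Fin r × Exponent n k → ℂ => koszulMap (tupleOfCoeffs g))
    (fun g => syzygyMap (tupleOfCoeffs g)) isPolynomialMap_koszulMap isPolynomialMap_syzygyMap
    (fun g => syzygyMap_comp_koszulMap _) g₀ h2
  refine ⟨b₁ * b₂, fun h => ?_, fun g hg => ?_⟩
  · exact mul_ne_zero hb₁ hb₂ (by rw [← map_mul, h, map_zero])
  · rw [map_mul] at hg
    refine ⟨le_bot_iff.mp ((hb₁' g (left_ne_zero_of_mul hg)).trans ?_),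
      hb₂' g (right_ne_zero_of_mul hg)⟩
    simp

/-! ### Decompositions in the span of g and orthogonal matrices -/

theorem combinationMap_apply {n k r : ℕ} (g : Fin r → Form n k) (c : Fin r → ℂ) :
    combinationMap g c = ∑ i, c i • g i := rfl

theorem IsKoszulSaturated.mem_span {n k r : ℕ} {g : Fin r → Form n k} (hg : IsKoszulSaturated g)
    (p : Form n k) (h : ∀ q : Exponent n k, ∃ a : Fin r → Form n k,
      (p * monomialForm q : MvPolynomial (Fin (n + 1)) ℂ) = ∑ j, (a j * g j : MvPolynomial (Fin (n + 1)) ℂ)) :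
    ∃ c : Fin r → ℂ, p = ∑ j, c j • g j := by
  choose a ha using h
  obtain ⟨u, hu⟩ := hg.2 (x := (p, a)) (by
    rw [LinearMap.mem_ker]
    funext q
    exact sub_eq_zero.mpr (ha q))
  exact ⟨u.1, (congrArg Prod.fst hu).symm⟩

/-- A symmetric quadratic relation with constant coefficients is trivial. -/
theorem IsKoszulSaturated.eq_zero_of_isSymm {n k r : ℕ} {g : Fin r → Form n k}
    (hg : IsKoszulSaturated g) (M : Matrix (Fin r) (Fin r) ℂ) (hM : M.IsSymm)
    (h : ∑ i, ∑ j, M i j • (g j * g i : MvPolynomial (Fin (n + 1)) ℂ) = 0) : M = 0 := by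
  -- The relation is a syzygy with p = 0. Being Koszul, it makes M equal to κ − κᵀ, hence
  -- antisymmetric as well as symmetric.
  obtain ⟨⟨c, κ⟩, hu⟩ := hg.2 (x := (0, fun _ i => ∑ j, M i j • g j)) (by
    rw [LinearMap.mem_ker]
    funext q
    simpa [syzygyMap, Finset.sum_mul] using h)
  have hinj := LinearMap.ker_eq_bot'.mp hg.1
  have hc : c = 0 := hinj c (congrArg Prod.fst hu)
  let q : Exponent n k := Exponent.mk (Finsupp.single 0 k) (Finsupp.degree_single _ _)
  have hκ : ∀ i j, M i j = κ q i j - κ q j i := by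
    intro i j
    have h1 : c i • monomialForm q + ∑ j, (κ q i j - κ q j i) • g j = ∑ j, M i j • g j :=
      congrFun (congrFun (congrArg Prod.snd hu) q) i
    rw [hc, Pi.zero_apply, zero_smul, zero_add] at h1
    have h2 := hinj ((fun j => M i j) - fun j => κ q i j - κ q j i) (by
      rw [map_sub, combinationMap_apply, combinationMap_apply, h1, sub_self])
    exact sub_eq_zero.mp (congrFun h2 j)
  ext i j
  have h1 := hκ i j
  have h2 := hκ j i
  rw [hM.apply i j] at h2
  have h3 : 2 * M i j = 0 := by linear_combination h1 + h2
  simpa using h3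

theorem sum_sq_sum_smul {n k r : ℕ} (g : Fin r → Form n k) (A : Matrix (Fin r) (Fin r) ℂ) :
    ∑ i, ((∑ j, A i j • g j : Form n k) : MvPolynomial (Fin (n + 1)) ℂ) ^ 2 =
      ∑ i, ∑ j, (A.transpose * A) i j • (g j * g i : MvPolynomial (Fin (n + 1)) ℂ) := by
  simp only [AddSubmonoidClass.coe_finsetSum, Submodule.coe_smul, pow_two, Finset.sum_mul_sum,
    smul_mul_smul_comm, Matrix.mul_apply, Matrix.transpose_apply, Finset.sum_smul]
  rw [Finset.sum_comm]
  refine Finset.sum_congr rfl fun i _ => ?_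
  rw [Finset.sum_comm]
  exact Finset.sum_congr rfl fun j _ => Finset.sum_congr rfl fun l _ =>
    congrArg _ (mul_comm _ _)

theorem sum_smul_one_mul {n k r : ℕ} (g : Fin r → Form n k) :
    ∑ i, ∑ j, (1 : Matrix (Fin r) (Fin r) ℂ) i j • (g j * g i : MvPolynomial (Fin (n + 1)) ℂ) =
      ∑ i, (g i : MvPolynomial (Fin (n + 1)) ℂ) ^ 2 := by
  refine Finset.sum_congr rfl fun i _ => ?_
  rw [Finset.sum_eq_single i]
  · simp [pow_two]
  · intro j _ hj
    rw [Matrix.one_apply_ne hj.symm, zero_smul]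
  · simp

theorem sum_sq_eq_of_mem_orthogonalOrbit {n k r : ℕ} {g h : Fin r → Form n k}
    (hh : h ∈ orthogonalOrbit g) :
    ∑ i, (h i : MvPolynomial (Fin (n + 1)) ℂ) ^ 2 =
      ∑ i, (g i : MvPolynomial (Fin (n + 1)) ℂ) ^ 2 := by
  obtain ⟨A, hA, hhA⟩ := hh
  simp only [hhA, sum_sq_sum_smul, mul_eq_one_comm.mp hA, sum_smul_one_mul]

/-- Saturation gives h = Ag. Comparing sums of squares yields a quadratic relation with symmetric
matrix 1 − AᵀA, which must vanish. -/
theorem IsKoszulSaturated.mem_orthogonalOrbit {n k r : ℕ} {g h : Fin r → Form n k}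
    (hg : IsKoszulSaturated g)
    (hsq : ∑ i, (h i : MvPolynomial (Fin (n + 1)) ℂ) ^ 2 =
      ∑ i, (g i : MvPolynomial (Fin (n + 1)) ℂ) ^ 2)
    (hspan : ∀ i, ∀ q : Exponent n k, ∃ a : Fin r → Form n k,
      (h i * monomialForm q : MvPolynomial (Fin (n + 1)) ℂ) =
        ∑ j, (a j * g j : MvPolynomial (Fin (n + 1)) ℂ)) :
    h ∈ orthogonalOrbit g := by
  obtain ⟨A, hA⟩ : ∃ A : Matrix (Fin r) (Fin r) ℂ, ∀ i, h i = ∑ j, A i j • g j := by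
    choose A hA using fun i => hg.mem_span (h i) (hspan i)
    exact ⟨Matrix.of A, hA⟩
  refine ⟨A, ?_, hA⟩
  rw [mul_eq_one_comm]
  have h1 := sum_sq_sum_smul g A
  simp only [← hA, hsq] at h1
  rw [← sum_smul_one_mul, ← sub_eq_zero] at h1
  have h2 := hg.eq_zero_of_isSymm (1 - Matrix.transpose A * A)
    (by simp [Matrix.IsSymm, Matrix.transpose_sub, Matrix.transpose_mul]) (by
      simpa only [Matrix.sub_apply, sub_smul, Finset.sum_sub_distrib] using h1)
  exact (sub_eq_zero.mp h2).symm

/-- If the decompositions of `f` form the orbit of a linearly independent tuple of length `r`,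
then `f` is not a sum of fewer than `r` squares. -/
theorem twoRank_eq_of_sosDecompositions_eq {n d r : ℕ} {f : Form n d}
    {g : Fin r → Form n (d / 2)} (hg : LinearMap.ker (combinationMap g) = ⊥)
    (hf : g ∈ sosDecompositions r f) (horb : sosDecompositions r f = orthogonalOrbit g) :
    twoRank f = r := by
  have hmem : r ∈ {r | f ∈ sumsOfSquares n d r} := ⟨g, hf⟩
  refine le_antisymm (Nat.sInf_le hmem) (not_lt.mp fun hlt => ?_)
  have hs : twoRank f ∈ {r | f ∈ sumsOfSquares n d r} := Nat.sInf_mem ⟨r, hmem⟩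
  obtain ⟨h, hh⟩ := hs
  obtain ⟨s, hs⟩ : ∃ s, r = twoRank f + (s + 1) := ⟨r - twoRank f - 1, by omega⟩
  generalize twoRank f = m at hlt h hh hs
  subst hs
  -- A shorter decomposition padded by zeros lies in the orbit; independence makes the row of A at a
  -- zero entry vanish, contradicting AAᵀ = 1.
  have hpad : (Fin.append h fun _ => 0) ∈ sosDecompositions (m + (s + 1)) f := by
    change _ = _
    rw [Fin.sum_univ_add, hh]
    simp
  rw [horb] at hpad
  obtain ⟨A, hA, hhA⟩ := hpad
  have h0 := hhA (Fin.natAdd m 0)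
  rw [Fin.append_right] at h0
  have hrow := LinearMap.ker_eq_bot'.mp hg (A (Fin.natAdd m 0)) h0.symm
  have h1 := congrFun (congrFun hA (Fin.natAdd m 0)) (Fin.natAdd m 0)
  rw [Matrix.mul_apply, Matrix.one_apply_eq] at h1
  simp [hrow] at h1

/-! ### Comparison of tangent spaces at two decompositions -/

/-- The chain rule for polynomials: differentials of relations kill tangent vectors. -/
theorem sum_eval_pderiv_eq_zero_of_aeval_eq_zero {ι τ k : Type*} [Fintype ι] [Fintype τ] [Field k]
    (φ : τ → MvPolynomial ι k) (P : MvPolynomial τ k) (hP : aeval φ P = 0) (h w : ι → k) :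
    ∑ t, eval (fun t => eval h (φ t)) (pderiv t P) * ∑ i, eval h (pderiv i (φ t)) * w i = 0 := by
  have h1 := aeval_inl_add_inr (R := k) (fun t => eval h (φ t))
    (fun t => ∑ i, eval h (pderiv i (φ t)) * w i) P
  have h2 : (fun t => (TrivSqZeroExt.inl (eval h (φ t)) +
      TrivSqZeroExt.inr (∑ i, eval h (pderiv i (φ t)) * w i) : TrivSqZeroExt k k)) =
      fun t => aeval (fun i => (TrivSqZeroExt.inl (h i) + TrivSqZeroExt.inr (w i) :
        TrivSqZeroExt k k)) (φ t) := by
    funext t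
    rw [aeval_inl_add_inr]
    simp only [aeval_eq_eval]
  have h3 : aeval (fun t => aeval (fun i => (TrivSqZeroExt.inl (h i) + TrivSqZeroExt.inr (w i) :
      TrivSqZeroExt k k)) (φ t)) P = 0 := by
    have := congrArg (aeval (fun i => (TrivSqZeroExt.inl (h i) + TrivSqZeroExt.inr (w i) :
      TrivSqZeroExt k k))) hP
    rw [map_zero] at this
    rw [← this, ← AlgHom.comp_apply, comp_aeval]
  rw [h2, h3] at h1
  have h4 := congrArg TrivSqZeroExt.snd h1
  simp only [TrivSqZeroExt.snd_add, TrivSqZeroExt.snd_inl, TrivSqZeroExt.snd_inr, zero_add,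
    TrivSqZeroExt.snd_zero, aeval_eq_eval] at h4
  exact h4.symm

/-- Generically, every tuple with the same sum of squares as `g` has its tangent space inside that
of `g`. -/
theorem exists_generic_mul_mem_ideal (n k r : ℕ) :
    ∃ b : MvPolynomial (Fin r × Exponent n k) ℂ, b ≠ 0 ∧ ∀ g, eval g b ≠ 0 →
      ∀ h : Fin r → Form n k,
        ∑ i, (h i : MvPolynomial (Fin (n + 1)) ℂ) ^ 2 =
          ∑ i, (tupleOfCoeffs g i : MvPolynomial (Fin (n + 1)) ℂ) ^ 2 →
        ∀ i, ∀ q : Exponent n k, ∃ a : Fin r → Form n k,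
          (h i * monomialForm q : MvPolynomial (Fin (n + 1)) ℂ) =
            ∑ j, (a j * tupleOfCoeffs g j : MvPolynomial (Fin (n + 1)) ℂ) := by
  obtain ⟨b, hb, hb'⟩ := exists_generic_tangent
    (fun m : Exponent n (2 * k) => sumSqCoeff n k r m)
  refine ⟨b, hb, fun g hg h hsq i q => ?_⟩
  let h' : Fin r × Exponent n k → ℂ := fun x =>
    coeff (x.2 : Fin (n + 1) →₀ ℕ) (h x.1 : MvPolynomial (Fin (n + 1)) ℂ)
  have hh' : tupleOfCoeffs h' = h := tupleOfCoeffs_coeff h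
  have hval : ∀ m : Fin (n + 1) →₀ ℕ,
      eval h' (sumSqCoeff n k r m) = eval g (sumSqCoeff n k r m) := fun m => by
    rw [eval_sumSqCoeff, eval_sumSqCoeff, hh', hsq]
  -- Moving hᵢ in the direction q gives the tangent vector 2hᵢq. It is killed by the differentials
  -- of all relations at f, which is also the image of g.
  let w' : Fin r × Exponent n k → ℂ := Pi.single (i, q) 1
  obtain ⟨w, hw⟩ := hb' g hg
    (fun m => ∑ x, eval h' (pderiv x (sumSqCoeff n k r m)) * w' x) (fun P hP => by
      simp only [← hval]
      exact sum_eval_pderiv_eq_zero_of_aeval_eq_zero _ P hP h' w')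
  simp only [sum_eval_pderiv_sumSqCoeff, hh'] at hw
  have hw'1 : ∀ j, tupleOfCoeffs w' j = if j = i then monomialForm q else 0 := by
    intro j
    rw [tupleOfCoeffs, Finset.sum_eq_single q]
    · by_cases hj : j = i <;> simp [w', hj]
    · intro e _ he
      simp [w', he]
    · simp
  have hhom : ∀ u v : Fin r → Form n k,
      (∑ i, 2 * (u i * v i : MvPolynomial (Fin (n + 1)) ℂ)).IsHomogeneous (2 * k) := by
    intro u v
    refine IsHomogeneous.sum _ _ _ fun i _ => ?_
    have h1 := ((u i).2.mul (v i).2).C_mul (2 : ℂ)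
    rw [← two_mul] at h1
    exact h1
  have heq : ∑ j, 2 * (h j * tupleOfCoeffs w' j : MvPolynomial (Fin (n + 1)) ℂ) =
      ∑ j, 2 * (tupleOfCoeffs g j * tupleOfCoeffs w j : MvPolynomial (Fin (n + 1)) ℂ) := by
    ext m
    by_cases hm : m.degree = 2 * k
    · exact hw (Exponent.mk m hm)
    · rw [IsHomogeneous.coeff_eq_zero (hhom _ _) hm, IsHomogeneous.coeff_eq_zero (hhom _ _) hm]
  refine ⟨tupleOfCoeffs w, ?_⟩
  rw [← Finset.mul_sum, ← Finset.mul_sum] at heq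
  have h2 := mul_left_cancel₀ two_ne_zero heq
  rw [Finset.sum_eq_single i] at h2
  · rw [hw'1, if_pos rfl] at h2
    rw [h2]
    exact Finset.sum_congr rfl fun j _ => mul_comm _ _
  · intro j _ hj
    rw [hw'1, if_neg hj]
    simp
  · simp

/-! ### Genericity on the secant variety and conclusion -/

theorem evalCoeffs_eq_eval {n d r : ℕ} {f : Form n d} {g : Fin r × Exponent n (d / 2) → ℂ}
    (hg : tupleOfCoeffs g ∈ sosDecompositions r f) (P : MvPolynomial (Fin (n + 1) →₀ ℕ) ℂ) :
    evalCoeffs P f = eval g (aeval (sumSqCoeff n (d / 2) r) P) := by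
  rw [eval_aeval_eq, evalCoeffs]
  congr 2
  funext m
  rw [eval_sumSqCoeff]
  exact congrArg (coeff m) hg

/-- Polynomials vanishing on all sums of `r` squares vanish on the secant variety. -/
theorem evalCoeffs_eq_zero_of_mem_secantSq {n d r : ℕ} {f : Form n d} (hf : f ∈ secantSq n d r)
    (P : MvPolynomial (Fin (n + 1) →₀ ℕ) ℂ) (hP : aeval (sumSqCoeff n (d / 2) r) P = 0) :
    evalCoeffs P f = 0 := by
  have hcl : IsClosed (zeroSet (n := n) (k := d) {P}) :=
    (isClosed_iff_exists_zeroSet _).mpr ⟨_, rfl⟩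
  have hsub : sumsOfSquares n d r ⊆ zeroSet {P} := by
    rintro f ⟨g, hg⟩ Q rfl
    rw [← tupleOfCoeffs_coeff g] at hg
    rw [evalCoeffs_eq_eval hg, hP, map_zero]
  exact closure_minimal hsub hcl hf P rfl

/-- A sum of `r` squares of forms of degree `d / 2` as a form of degree `d`. -/
theorem exists_form_of_tuple {n d r : ℕ} (hd : Even d) (g : Fin r → Form n (d / 2)) :
    ∃ f : Form n d, g ∈ sosDecompositions r f := by
  refine ⟨⟨∑ i, (g i : MvPolynomial (Fin (n + 1)) ℂ) ^ 2, ?_⟩, rfl⟩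
  refine IsHomogeneous.sum _ _ _ fun i _ => ?_
  have h := (g i).2.pow 2
  rwa [Nat.div_two_mul_two_of_even hd] at h

/-- The complement of a hypersurface which does not contain all sums of squares is dense in the
secant variety. -/
theorem secantSq_subset_closure_inter {n d r : ℕ} (hd : Even d)
    (Q : MvPolynomial (Fin (n + 1) →₀ ℕ) ℂ) (hQ : aeval (sumSqCoeff n (d / 2) r) Q ≠ 0) :
    secantSq n d r ⊆ closure (secantSq n d r ∩ {f | evalCoeffs Q f ≠ 0}) := by
  refine closure_minimal ?_ isClosed_closure
  obtain ⟨S, hS⟩ := (isClosed_iff_exists_zeroSet _).mp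
    (isClosed_closure (s := secantSq n d r ∩ {f | evalCoeffs Q f ≠ 0}))
  rw [hS]
  rintro f ⟨g, hg⟩ P hPS
  have hP : aeval (sumSqCoeff n (d / 2) r) P = 0 := by
    -- PQ vanishes at every sum of squares, so its pullback to the parameter space is zero;
    -- polynomial rings are domains and Q pulls back to a nonzero polynomial.
    refine (mul_eq_zero.mp (MvPolynomial.funext fun g => ?_)).resolve_right hQ
    obtain ⟨f, hf⟩ := exists_form_of_tuple hd (tupleOfCoeffs g)
    rw [map_mul, map_zero, ← evalCoeffs_eq_eval hf, ← evalCoeffs_eq_eval hf]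
    by_cases h0 : evalCoeffs Q f = 0
    · rw [h0, mul_zero]
    · have hmem : f ∈ zeroSet S := hS ▸ subset_closure
        ⟨subset_closure ⟨_, hf⟩, h0⟩
      rw [hmem P hPS, zero_mul]
  rw [← tupleOfCoeffs_coeff g] at hg
  rw [evalCoeffs_eq_eval hg, hP, map_zero]

theorem holdsGenerically_isOrthIdentifiable {n d r : ℕ} (hd : Even d) (hk : d / 2 ≠ 0)
    (hnk : d ≤ (n + 1) * (d / 2 - 1)) (hr : r ≤ n + 1) :
    HoldsGenerically (secantSq n d r) (IsOrthIdentifiable r) := by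
  have hdk : 2 * (d / 2) = d := Nat.two_mul_div_two_of_even hd
  obtain ⟨b₁, hb₁, hsat⟩ := exists_generic_isKoszulSaturated (n := n) hk (hdk.le.trans hnk) hr
  obtain ⟨b₂, hb₂, htan⟩ := exists_generic_mul_mem_ideal n (d / 2) r
  obtain ⟨Q, hQ, hpre⟩ := exists_preimage_of_generic
    (fun m : Exponent n d => sumSqCoeff n (d / 2) r m) (b₁ * b₂) (mul_ne_zero hb₁ hb₂)
  -- Polynomials in the finitely many coefficients of degree d are transported to the variables
  -- indexed by all exponent vectors, as used by the topology.
  have hren : ∀ (P : MvPolynomial (Exponent n d) ℂ),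
      aeval (sumSqCoeff n (d / 2) r) (rename Subtype.val P) =
        aeval (fun m : Exponent n d => sumSqCoeff n (d / 2) r m) P := fun P => aeval_rename _ _ P
  have heval : ∀ (P : MvPolynomial (Exponent n d) ℂ) (f : Form n d),
      evalCoeffs (rename Subtype.val P) f =
        eval (fun m : Exponent n d => coeff (m : Fin (n + 1) →₀ ℕ)
          (f : MvPolynomial (Fin (n + 1)) ℂ)) P := fun P f => eval_rename _ _ P
  refine ⟨{f | evalCoeffs (rename Subtype.val Q) f ≠ 0}, ?_,
    secantSq_subset_closure_inter hd _ (by rwa [hren]), ?_⟩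
  · rw [← isClosed_compl_iff, isClosed_iff_exists_zeroSet]
    refine ⟨{rename Subtype.val Q}, ?_⟩
    ext f
    simp [zeroSet]
  · rintro f ⟨hfX, hfQ⟩
    -- Off the hypersurface, a point of the closure is an actual sum of squares, with a
    -- decomposition `g` that is generic in both senses.
    obtain ⟨g, hgb, hgf⟩ := hpre
      (fun m => coeff (m : Fin (n + 1) →₀ ℕ) (f : MvPolynomial (Fin (n + 1)) ℂ))
      (fun P hP => by
        rw [← heval]
        exact evalCoeffs_eq_zero_of_mem_secantSq hfX _ (by rw [hren, hP]))
      (by rw [← heval]; exact hfQ)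
    rw [map_mul] at hgb
    have hg := hsat g (left_ne_zero_of_mul hgb)
    have hdec : tupleOfCoeffs g ∈ sosDecompositions r f := by
      obtain ⟨f', hf'⟩ := exists_form_of_tuple hd (tupleOfCoeffs g)
      have : f = f' := Form.ext_coeff fun m hm => by
        have h1 := hgf (Exponent.mk m hm)
        rw [eval_sumSqCoeff] at h1
        exact h1.symm.trans (congrArg (coeff m) hf').symm
      rwa [this]
    have horb : sosDecompositions r f = orthogonalOrbit (tupleOfCoeffs g) := by
      ext h
      constructor
      · intro hh
        have hsq := hh.symm.trans hdec
        exact hg.mem_orthogonalOrbit hsq (htan g (right_ne_zero_of_mul hgb) h hsq)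
      · intro hh
        exact hdec.trans (sum_sq_eq_of_mem_orthogonalOrbit hh).symm
    exact ⟨twoRank_eq_of_sosDecompositions_eq hg.1 hdec horb, _, hdec, horb⟩

theorem mainTheorem1 (n d r : ℕ) (hn : 2 ≤ n) (hd : Even d)
    (hdn : 2 + 4 / ((n : ℝ) - 1) ≤ (d : ℝ)) (hr : r ≤ n + 1) :
    HoldsGenerically (secantSq n d r) (IsOrthIdentifiable r) := by
  obtain ⟨k, hk⟩ := hd
  obtain ⟨m, rfl⟩ : ∃ m, n = m + 2 := ⟨n - 2, by omega⟩
  have hm : (0 : ℝ) < m + 1 := by positivity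
  -- Clearing the denominator gives (d−2)(n−1) ≥ 4. With d = 2(l+1) this is l(n−1) ≥ 2, equivalent
  -- to 2k ≤ (n+1)(k−1) for k = l+1.
  have h1 : (2 : ℝ) * (m + 1) + 4 ≤ d * (m + 1) := by
    have h2 : ((m + 2 : ℕ) : ℝ) - 1 = m + 1 := by push_cast; ring
    rw [h2] at hdn
    have h3 := mul_le_mul_of_nonneg_right hdn hm.le
    rwa [add_mul, div_mul_cancel₀ _ hm.ne'] at h3
  have h4 : 2 * (m + 1) + 4 ≤ d * (m + 1) := by exact_mod_cast h1
  have hk2 : d / 2 = k := by omega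
  have hk1 : k ≠ 0 := by
    rintro rfl
    simp [hk] at h4
  refine holdsGenerically_isOrthIdentifiable ⟨k, hk⟩ (by rwa [hk2]) ?_ hr
  rw [hk2]
  obtain ⟨l, rfl⟩ : ∃ l, k = l + 1 := ⟨k - 1, by omega⟩
  subst hk
  simp only [Nat.add_sub_cancel]
  nlinarith
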